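/- **Setting.** Let $d$ be a prime, $F=\mathbb{Z}/d\mathbb{Z}$, and let $\mathsf H$ be a Hilbert space with orthonormal basis $\{|j\rangle\}_{j\in F}$. Let $\omega$ be a primitive $d$-th root of unity, $X|j\rangle=|j-1\rangle$, $Z|j\rangle=\omega^j|j\rangle$, $N_{(i,j)}=X^iZ^j$, and $N_x=N_{x_1}\otimes\dots\otimes N_{x_n}$ for $x\in(F^2)^n\cong F^{2n}$. Equip $F^{2n}$ with the symplectic form $\langle x,y\rangle=\sum_{i=1}^n(u_iv_i'-v_iu_i')$, where $x_i=(u_i,v_i)$ and $y_i=(u'_i,v'_i)$. Let $P$ be a probability distribution on $F^2$, let $P^n$ be its $n$-fold product, and let $\mathcal A(\rho)=\sum_{u\in F^2}P(u)N_u\rho N_u^\dagger$ be the corresponding Pauli channel. All logarithms are to base $d$, and $0\log 0=0$. $H$ denotes the Shannon entropy and $S$ the von Neumann entropy. **Code.** Let $0\le k\le n$ and let $L\subset F^{2n}$ be a subspace with $L\subset L^\perp$ and $\dim L=n-k$. Let $g_1,\dots,g_n,h_1,\dots,h_n\in F^{2n}$ satisfy $L=\mathrm{span}\{g_1,\dots,g_{n-k}\}$,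 $\langle g_i,h_j\rangle=\delta_{ij}$ and $\langle g_i,g_j\rangle=\langle h_i,h_j\rangle=0$ for all $i,j$. Let $\mathcal C\subset\mathsf H^{\otimes n}$ be a symplectic code with stabilizer $N_L=\{N_x\mid x\in L\}$, that is, a $d^k$-dimensional subspace of the form $\{\psi\mid M\psi=\tau(M)\psi\ \ \forall M\in N_L\}$ with scalars $\tau(M)$. **Probability array.** For $s\in F^{n-k}$ and $u=((u_1,u_1'),\dots,(u_k,u_k'))\in (F^{2})^k$ let $P_L(s,u)$ be the sum of $P^n(x)$ over all $x=\sum_{i=1}^n(w_ig_i+z_ih_i)$ (with $w_i,z_i\in F$) such that $z_i=s_i$ for $i\le n-k$ and $(w_i,z_i)=(u_{i-n+k},u'_{i-n+k})$ for $i>n-k$. Let $\overline{P_L}(s)=\sum_uP_L(s,u)$ be the row marginal, let $\overleftarrow{P_L}(u|s)=P_L(s,u)/\overline{P_L}(s)$ where $\overline{P_L}(s)>0$, and let $$H(\overleftarrow{P_L}|\overline{P_L})=-\sum_{s:\,\overline{P_L}(s)>0}\ \sum_u\overline{P_L}(s)\,\overleftarrow{P_L}(u|s)\log_d\overleftarrow{P_L}(u|s).$$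 **Claim.** Let $\rho=(\dim\mathcal C)^{-1}\Pi_{\mathcal C}$, where $\Pi_{\mathcal C}$ is the orthogonal projection onto $\mathcal C$. Let $I_{\rm c}(\rho,\mathcal A^{\otimes n})=S(\mathcal A^{\otimes n}(\rho))-S([\mathrm I\otimes\mathcal A^{\otimes n}](|\Psi\rangle\langle\Psi|))$ be the coherent information, with $|\Psi\rangle$ a purification of $\rho$. Then $$k-H(\overleftarrow{P_L}|\overline{P_L})=I_{\rm c}(\rho,\mathcal A^{\otimes n}).$$ Moreover $$S(\mathcal A^{\otimes n}(\rho))=H(\overline{P_L})+k,$$ and, for every purification $|\Psi\rangle$ of $\rho$ by a finite-dimensional reference system, $$S\big([\mathrm I\otimes\mathcal A^{\otimes n}](|\Psi\rangle\langle\Psi|)\big)=H(\overline{P_L})+H(\overleftarrow{P_L}|\overline{P_L}).$$ -/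

import Mathlib

open scoped Matrix

noncomputable section

namespace SympCode

/-! ### Classical distributions and entropies (logarithms to base `d`) -/

/-- `P` is a probability distribution on the finite set `Y`. -/
def IsProbDist {Y : Type*} [Fintype Y] (P : Y → ℝ) : Prop :=
  (∀ y, 0 ≤ P y) ∧ ∑ y, P y = 1

/-- Shannon entropy to base `d`: `H(Q) = - ∑ u, Q(u) log_d Q(u)`. -/
def shannonEntropy (d : ℕ) {Y : Type*} [Fintype Y] (Q : Y → ℝ) : ℝ :=
  -∑ u, Q u * Real.logb d (Q u)

/-- The marginal on the first component. -/
def marginal {Y Z : Type*} [Fintype Z] (Q : Y × Z → ℝ) (u : Y) : ℝ :=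
  ∑ v, Q (u, v)

/-- The conditional distribution `Q(u, v) / ∑ v', Q(u, v')` of the second component given
the first; it is only used at those `u` whose marginal probability is positive. -/
def conditional {Y Z : Type*} [Fintype Z] (Q : Y × Z → ℝ) (u : Y) (v : Z) : ℝ :=
  Q (u, v) / marginal Q u

open Classical in
/-- The entropy `H(W | p)` of the stochastic matrix `W(v | u)` conditional on `p`, to base `d`. -/
def condEntropy (d : ℕ) {Y Z : Type*} [Fintype Y] [Fintype Z]
    (W : Y → Z → ℝ) (p : Y → ℝ) : ℝ :=
  -∑ u ∈ Finset.univ.filter (fun u => 0 < p u), ∑ v, p u * W u v * Real.logb d (W u v)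

/-- The product distribution `P^n`. -/
def prodDist {Y : Type*} {n : ℕ} (P : Y → ℝ) (x : Fin n → Y) : ℝ :=
  ∏ t, P (x t)

/-! ### Linear maps on operators, purifications, coherent information

Operators on a Hilbert space with a fixed orthonormal basis indexed by `ι` are matrices. -/

/-- The linear map `ρ ↦ ∑ i, K i * ρ * (K i)ᴴ` with operator-sum representation `K`. -/
def krausMap {ι κ : Type*} [Fintype ι] [Fintype κ] (K : κ → Matrix ι ι ℂ) :
    Matrix ι ι ℂ →ₗ[ℂ] Matrix ι ι ℂ where
  toFun ρ := ∑ i, K i * ρ * (K i)ᴴ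
  map_add' ρ σ := by simp [Matrix.mul_add, Matrix.add_mul, Finset.sum_add_distrib]
  map_smul' c ρ := by simp [Finset.smul_sum]

/-- The tensor power `M^{⊗n}` of a linear map on operators: the linear map that sends a tensor
product of matrix units `⊗ₜ E_{i(t), j(t)}` to `⊗ₜ M (E_{i(t), j(t)})`. -/
def tensorPower {ι : Type*} [Fintype ι] [DecidableEq ι] (n : ℕ)
    (M : Matrix ι ι ℂ →ₗ[ℂ] Matrix ι ι ℂ) :
    Matrix (Fin n → ι) (Fin n → ι) ℂ →ₗ[ℂ] Matrix (Fin n → ι) (Fin n → ι) ℂ where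
  toFun ρ := Matrix.of fun a b =>
    ∑ i, ∑ j, ρ i j * ∏ t, M (Matrix.single (i t) (j t) 1) (a t) (b t)
  map_add' ρ σ := by
    ext a b
    simp [add_mul, Finset.sum_add_distrib]
  map_smul' c ρ := by
    ext a b
    simp [Finset.mul_sum, mul_assoc]

/-- The map `I ⊗ M`, where `I` is the identity map on the operators of a reference system with
basis indexed by `R`: it applies `M` to each `ι × ι` block. -/
def idTensor (R : Type*) {ι : Type*} (M : Matrix ι ι ℂ →ₗ[ℂ] Matrix ι ι ℂ) :
    Matrix (R × ι) (R × ι) ℂ →ₗ[ℂ] Matrix (R × ι) (R × ι) ℂ where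
  toFun σ := Matrix.of fun a b => M (Matrix.of fun i j => σ (a.1, i) (b.1, j)) a.2 b.2
  map_add' σ τ := by
    ext a b
    exact congrFun (congrFun (M.map_add (Matrix.of fun i j => σ (a.1, i) (b.1, j))
      (Matrix.of fun i j => τ (a.1, i) (b.1, j))) a.2) b.2
  map_smul' c σ := by
    ext a b
    exact congrFun (congrFun (M.map_smul c (Matrix.of fun i j => σ (a.1, i) (b.1, j))) a.2) b.2

open Classical in
/-- Von Neumann entropy to base `d` of a density operator: `- ∑ λ log_d λ` over its eigenvalues,
counted with multiplicity (value `0` by convention for matrices that are not Hermitian). -/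
def vonNeumannEntropy (d : ℕ) {ι : Type*} [Fintype ι] (σ : Matrix ι ι ℂ) : ℝ :=
  if h : σ.IsHermitian then -∑ i, h.eigenvalues i * Real.logb d (h.eigenvalues i) else 0

/-- The operator `|Ψ⟩⟨Ψ|`. -/
def ketBra {ι : Type*} (Ψ : ι → ℂ) : Matrix ι ι ℂ :=
  Matrix.vecMulVec Ψ (star Ψ)

/-- The vector `Ψ` of the bipartite system purifies `ρ`: tracing out the reference system `R`
from `|Ψ⟩⟨Ψ|` gives `ρ`. -/
def IsPurification {R ι : Type*} [Fintype R] (Ψ : R × ι → ℂ) (ρ : Matrix ι ι ℂ) : Prop :=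
  ∀ i j, ∑ r, ketBra Ψ (r, i) (r, j) = ρ i j

open Classical in
/-- The canonical purification `∑ r, |r⟩ ⊗ √ρ |r⟩` of `ρ`. -/
def canonicalPurification {ι : Type*} [Fintype ι] (ρ : Matrix ι ι ℂ) : ι × ι → ℂ :=
  fun a => cfc Real.sqrt ρ a.2 a.1

open scoped ComplexOrder in
theorem isPurification_canonicalPurification {ι : Type*} [Fintype ι] {ρ : Matrix ι ι ℂ}
    (hρ : ρ.PosSemidef) : IsPurification (canonicalPurification ρ) ρ := by
  classical
  have key : cfc Real.sqrt ρ * star (cfc Real.sqrt ρ) = ρ := by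
    have hs : IsSelfAdjoint ρ := hρ.1
    rw [← cfc_star, ← cfc_mul Real.sqrt _ ρ (by fun_prop) (by fun_prop)]
    conv_rhs => rw [← cfc_id ℝ ρ]
    apply cfc_congr
    intro x hx
    have hx0 : 0 ≤ x := by
      rw [hρ.1.spectrum_real_eq_range_eigenvalues] at hx
      obtain ⟨i, rfl⟩ := hx
      exact hρ.eigenvalues_nonneg i
    simp [Real.mul_self_sqrt hx0]
  intro i j
  have h := congrFun (congrFun key i) j
  simpa [Matrix.mul_apply, canonicalPurification, ketBra, Matrix.vecMulVec_apply] using h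

/-- The coherent information
`I_c(ρ, M) = S(M(ρ)) - S([I ⊗ M](|Ψ⟩⟨Ψ|))`, with `Ψ` a purification of `ρ`. -/
def coherentInformation (d : ℕ) {ι : Type*} [Fintype ι] (ρ : Matrix ι ι ℂ)
    (M : Matrix ι ι ℂ →ₗ[ℂ] Matrix ι ι ℂ) : ℝ :=
  vonNeumannEntropy d (M ρ)
    - vonNeumannEntropy d (idTensor ι M (ketBra (canonicalPurification ρ)))

/-- The matrix of the orthogonal projection onto a subspace `C`. -/
def projMatrix {ι : Type*} [Fintype ι] [DecidableEq ι]
    (C : Submodule ℂ (EuclideanSpace ℂ ι)) : Matrix ι ι ℂ :=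
  Matrix.toEuclideanLin.symm (C.starProjection : EuclideanSpace ℂ ι →ₗ[ℂ] EuclideanSpace ℂ ι)

/-- The maximally mixed state `(dim C)⁻¹ Π_C` on a subspace `C`. -/
def maxMixed {ι : Type*} [Fintype ι] [DecidableEq ι]
    (C : Submodule ℂ (EuclideanSpace ℂ ι)) : Matrix ι ι ℂ :=
  (Module.finrank ℂ C : ℂ)⁻¹ • projMatrix C

/-! ### Weyl operators and Pauli channels -/

section Weyl

variable {d : ℕ} [NeZero d]

/-- `X |j⟩ = |j - 1⟩`. -/
def weylX (d : ℕ) : Matrix (ZMod d) (ZMod d) ℂ :=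
  Matrix.of fun i j => if i = j - 1 then 1 else 0

/-- `Z |j⟩ = ω ^ j |j⟩`. -/
def weylZ (d : ℕ) (ω : ℂ) : Matrix (ZMod d) (ZMod d) ℂ :=
  Matrix.diagonal fun j => ω ^ j.val

/-- `N_{(i, j)} = X ^ i Z ^ j`. -/
def weyl (ω : ℂ) (u : ZMod d × ZMod d) : Matrix (ZMod d) (ZMod d) ℂ :=
  weylX d ^ u.1.val * weylZ d ω ^ u.2.val

/-- `N_x = N_{x_1} ⊗ ⋯ ⊗ N_{x_n}`. -/
def weylN (ω : ℂ) {n : ℕ} (x : Fin n → ZMod d × ZMod d) :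
    Matrix (Fin n → ZMod d) (Fin n → ZMod d) ℂ :=
  Matrix.of fun a b => ∏ t, weyl ω (x t) (a t) (b t)

/-- The Pauli channel with operator-sum representation `{√P(u) N_u}`. -/
def pauliChannel (ω : ℂ) (P : ZMod d × ZMod d → ℝ) :
    Matrix (ZMod d) (ZMod d) ℂ →ₗ[ℂ] Matrix (ZMod d) (ZMod d) ℂ :=
  krausMap fun u => ((Real.sqrt (P u) : ℝ) : ℂ) • weyl ω u

/-! ### Symplectic geometry and symplectic codes -/

/-- The standard symplectic form `∑ i, (u_i v'_i - v_i u'_i)`. -/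
def symp {n : ℕ} (x y : Fin n → ZMod d × ZMod d) : ZMod d :=
  ∑ i, ((x i).1 * (y i).2 - (x i).2 * (y i).1)

/-- `L^⊥`, as a set. -/
def perp {n : ℕ} (L : Submodule (ZMod d) (Fin n → ZMod d × ZMod d)) :
    Set (Fin n → ZMod d × ZMod d) :=
  {y | ∀ x ∈ L, symp x y = 0}

/-- `L ⊆ L^⊥`. -/
def IsSelfOrthogonal {n : ℕ} (L : Submodule (ZMod d) (Fin n → ZMod d × ZMod d)) : Prop :=
  (L : Set (Fin n → ZMod d × ZMod d)) ⊆ perp L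

/-- The set of operators `N_L = {N_x | x ∈ L}`. -/
def stabilizerSet (ω : ℂ) {n : ℕ} (L : Submodule (ZMod d) (Fin n → ZMod d × ZMod d)) :
    Set (Matrix (Fin n → ZMod d) (Fin n → ZMod d) ℂ) :=
  {M | ∃ x ∈ L, M = weylN ω x}

/-- `C` is a symplectic code with stabilizer `N_L`, where `dim L = n - k`: a `d ^ k`-dimensional
subspace of the form `{ψ | ∀ M ∈ N_L, M ψ = τ(M) ψ}`. -/
def IsSymplecticCode (ω : ℂ) {n : ℕ} (k : ℕ) (L : Submodule (ZMod d) (Fin n → ZMod d × ZMod d))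
    (C : Submodule ℂ (EuclideanSpace ℂ (Fin n → ZMod d))) : Prop :=
  Module.finrank ℂ C = d ^ k ∧
    ∃ τ : Matrix (Fin n → ZMod d) (Fin n → ZMod d) ℂ → ℂ,
      ∀ ψ, ψ ∈ C ↔ ∀ M ∈ stabilizerSet ω L, Matrix.toEuclideanLin M ψ = τ M • ψ

/-- The vectors `g_1, …, g_n, h_1, …, h_n` form mutually orthogonal hyperbolic pairs
`(g_i, h_i)`. -/
def IsHyperbolic {n : ℕ} (g h : Fin n → (Fin n → ZMod d × ZMod d)) : Prop :=
  ∀ i j, symp (g i) (h j) = (if i = j then 1 else 0) ∧ symp (g i) (g j) = 0 ∧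
    symp (h i) (h j) = 0

/-- The `i`-th of the first `n - k` indices. -/
def lowIdx {n : ℕ} (k : ℕ) (i : Fin (n - k)) : Fin n :=
  ⟨i, by omega⟩

/-- The `i`-th of the last `k` indices. -/
def highIdx {n k : ℕ} (hk : k ≤ n) (i : Fin k) : Fin n :=
  ⟨n - k + i, by omega⟩

open Classical in
/-- The distribution `P_L` on `F^{n-k} × F^{2k}`: the probability of `(s, u)` is the sum of
`P^n(x)` over the vectors `x = ∑ i, (w_i g_i + z_i h_i)` with `z_i = s_i` for the first `n - k`
indices and `(w_i, z_i) = u_{i-n+k}` for the last `k` indices. -/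
def cosetDist {n k : ℕ} (hk : k ≤ n) (g h : Fin n → (Fin n → ZMod d × ZMod d))
    (P : ZMod d × ZMod d → ℝ) :
    (Fin (n - k) → ZMod d) × (Fin k → ZMod d × ZMod d) → ℝ :=
  fun su => ∑ x ∈ Finset.univ.filter (fun x : Fin n → ZMod d × ZMod d =>
      ∃ w z : Fin n → ZMod d, x = ∑ i, (w i • g i + z i • h i) ∧
        (∀ i, z (lowIdx k i) = su.1 i) ∧
        (∀ i, w (highIdx hk i) = (su.2 i).1 ∧ z (highIdx hk i) = (su.2 i).2)),
    prodDist P x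

end Weyl

end SympCode

end

open SympCode

/-!
A Pauli channel on `n` systems applies the error `N_x` with probability `P^n(x)`. Let `B` be an
isometry with range the code, so that `ρ = d⁻ᵏ B Bᴴ`. Elements of `N_L` act on the code as phases,
and `N_z` commutes with the projection onto the code for `z ∈ L^⊥`. Hence `N_x ρ N_xᴴ` depends only
on the coset of `x` modulo `L^⊥`, and the ranges of `N_x B` and `N_y B` are orthogonal when the
cosets differ, because the phase relation between `N_{y - x}` and some element of `N_L` is then
nontrivial. The output is thus a mixture of orthogonal flat states of rank `d^k` weighted by the
distribution of the syndrome, which is the row marginal of `P_L`.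

In the presence of a reference system, the pure states `(1 ⊗ N_x)|Ψ⟩` and `(1 ⊗ N_y)|Ψ⟩` have inner
product `tr (N_xᴴ N_y ρ)`. They agree up to a phase when `x - y ∈ L`. Otherwise
`y - x ∉ L^⊥⊥ = L`, and conjugating by a suitable `N_z` with `z ∈ L^⊥`, which commutes with `ρ`,
multiplies the trace by a nontrivial phase, so it vanishes. The output is a mixture of orthogonal
pure states weighted by the distribution of the coset of `x` modulo `L`, which is all of `P_L`. The
chain rule for the Shannon entropy then gives the three identities.
-/

namespace SympCode

/-! ### Entropies of finite distributions -/

/-- The distribution of `f x` when `x` has distribution `p`. -/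
def pushforward {X S : Type*} [Fintype X] [DecidableEq S] (f : X → S) (p : X → ℝ) (s : S) : ℝ :=
  ∑ x with f x = s, p x

section Pushforward

variable {X S : Type*} [Fintype X] [DecidableEq S]

theorem pushforward_nonneg {p : X → ℝ} (hp : ∀ x, 0 ≤ p x) (f : X → S) (s : S) :
    0 ≤ pushforward f p s :=
  Finset.sum_nonneg fun x _ => hp x

theorem sum_pushforward [Fintype S] (f : X → S) (p : X → ℝ) :
    ∑ s, pushforward f p s = ∑ x, p x :=
  Finset.sum_fiberwise _ _ _

theorem sum_pushforward_smul [Fintype S] {M : Type*} [AddCommGroup M] [Module ℂ M] (f : X → S)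
    (p : X → ℝ) (F : S → M) :
    ∑ s, (pushforward f p s : ℂ) • F s = ∑ x, (p x : ℂ) • F (f x) := by
  rw [← Finset.sum_fiberwise Finset.univ f]
  refine Finset.sum_congr rfl fun s _ => ?_
  rw [pushforward, Complex.ofReal_sum, Finset.sum_smul]
  refine Finset.sum_congr rfl fun x hx => ?_
  rw [(Finset.mem_filter.1 hx).2]

theorem marginal_pushforward {Y Z : Type*} [DecidableEq Y] [Fintype Z] [DecidableEq Z]
    (f : X → Y × Z) (p : X → ℝ) :
    marginal (pushforward f p) = pushforward (fun x => (f x).1) p := by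
  funext y
  simp only [marginal, pushforward, Prod.ext_iff, ← Finset.filter_filter, Finset.sum_fiberwise]

end Pushforward

theorem IsProbDist.prodDist {Y : Type*} [Fintype Y] {P : Y → ℝ} (hP : IsProbDist P) (n : ℕ) :
    IsProbDist (SympCode.prodDist (n := n) P) :=
  ⟨fun x => Finset.prod_nonneg fun t _ => hP.1 (x t), by
    simp only [SympCode.prodDist, ← Fintype.sum_pow, hP.2, one_pow]⟩

theorem shannonEntropy_mul (d : ℕ) {Y Z : Type*} [Fintype Y] [Fintype Z] {Q : Y → ℝ} {W : Z → ℝ}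
    (hQ : ∑ y, Q y = 1) (hW : ∑ z, W z = 1) :
    shannonEntropy d (fun a : Y × Z => Q a.1 * W a.2)
      = shannonEntropy d Q + shannonEntropy d W := by
  have hlog : ∀ y z, Q y * W z * Real.logb d (Q y * W z)
      = Q y * Real.logb d (Q y) * W z + Q y * (W z * Real.logb d (W z)) := by
    intro y z
    rcases eq_or_ne (Q y) 0 with hy | hy
    · simp [hy]
    rcases eq_or_ne (W z) 0 with hz | hz
    · simp [hz]
    rw [Real.logb_mul hy hz]
    ring
  simp only [shannonEntropy, Fintype.sum_prod_type, hlog, Finset.sum_add_distrib,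
    ← Finset.mul_sum, ← Finset.sum_mul, hQ, hW]
  ring

theorem shannonEntropy_const_inv_card (d : ℕ) (Z : Type*) [Fintype Z] [Nonempty Z] :
    shannonEntropy d (fun _ : Z => (Fintype.card Z : ℝ)⁻¹) = Real.logb d (Fintype.card Z) := by
  simp [shannonEntropy, Real.logb_inv]

theorem shannonEntropy_eq_marginal_add_condEntropy (d : ℕ) {Y Z : Type*} [Fintype Y] [Fintype Z]
    {Q : Y × Z → ℝ} (hQ : ∀ a, 0 ≤ Q a) :
    shannonEntropy d Q
      = shannonEntropy d (marginal Q) + condEntropy d (conditional Q) (marginal Q) := by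
  classical
  have hle : ∀ u v, Q (u, v) ≤ marginal Q u := fun u v =>
    Finset.single_le_sum (f := fun v => Q (u, v)) (fun v _ => hQ (u, v)) (Finset.mem_univ v)
  have hlog : ∀ u v, Q (u, v) * Real.logb d (Q (u, v)) = Q (u, v) * Real.logb d (marginal Q u)
      + marginal Q u * conditional Q u v * Real.logb d (conditional Q u v) := by
    intro u v
    rcases (hQ (u, v)).eq_or_lt with h | h
    · simp [conditional, ← h]
    · have hm := (h.trans_le (hle u v)).ne'
      rw [conditional, mul_div_cancel₀ _ hm, Real.logb_div h.ne' hm]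
      ring
  have hsupport : ∀ u ∈ Finset.univ,
      ∑ v, marginal Q u * conditional Q u v * Real.logb d (conditional Q u v) ≠ 0 →
        0 < marginal Q u := by
    intro u _ hu
    refine (Finset.sum_nonneg fun v _ => hQ (u, v)).lt_of_ne' fun h : marginal Q u = 0 => hu ?_
    simp [h]
  rw [condEntropy, Finset.sum_filter_of_ne hsupport]
  simp only [shannonEntropy, Fintype.sum_prod_type, hlog, Finset.sum_add_distrib, ← Finset.sum_mul,
    neg_add]
  rfl

/-! ### Von Neumann entropy of orthogonal mixtures -/

theorem roots_charpoly_mul_diagonal_mul {K ι A : Type*} [Field K] [Fintype ι] [DecidableEq ι]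
    [Fintype A] [DecidableEq A] {V : Matrix ι A K} {W : Matrix A ι K} (hWV : W * V = 1)
    (p : A → K) :
    Fintype.card A • {0} + (V * Matrix.diagonal p * W).charpoly.roots
      = Fintype.card ι • {0} + Finset.univ.val.map p := by
  have hprod : (∏ a, (Polynomial.X - Polynomial.C (p a))) ≠ 0 :=
    Finset.prod_ne_zero_iff.2 fun a _ => Polynomial.X_sub_C_ne_zero _
  have hpow : ∀ m : ℕ, (Polynomial.X : Polynomial K) ^ m ≠ 0 :=
    fun m => pow_ne_zero m Polynomial.X_ne_zero
  have hchar := Matrix.charpoly_mul_comm' (V * Matrix.diagonal p) W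
  rw [← Matrix.mul_assoc W, hWV, Matrix.one_mul, Matrix.charpoly_diagonal] at hchar
  have hroots := congrArg Polynomial.roots hchar
  rw [Polynomial.roots_mul (mul_ne_zero (hpow _) (Matrix.charpoly_monic _).ne_zero),
    Polynomial.roots_mul (mul_ne_zero (hpow _) hprod), Polynomial.roots_X_pow,
    Polynomial.roots_X_pow, Polynomial.roots_prod _ _ hprod] at hroots
  simpa only [Polynomial.roots_X_sub_C, Multiset.bind_singleton] using hroots

theorem sum_eigenvalues_mul_diagonal_mul_conjTranspose {ι A : Type*} [Fintype ι] [DecidableEq ι]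
    [Fintype A] [DecidableEq A] {V : Matrix ι A ℂ} (hV : Vᴴ * V = 1) (p : A → ℝ)
    (hH : (V * Matrix.diagonal (fun a => (p a : ℂ)) * Vᴴ).IsHermitian) {f : ℝ → ℝ}
    (hf : f 0 = 0) : ∑ i, f (hH.eigenvalues i) = ∑ a, f (p a) := by
  have hroots := roots_charpoly_mul_diagonal_mul hV fun a => (p a : ℂ)
  rw [hH.roots_charpoly_eq_eigenvalues] at hroots
  simpa [Multiset.map_nsmul, Multiset.sum_nsmul, hf] using
    congrArg (fun s : Multiset ℂ => (s.map fun z => f z.re).sum) hroots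

theorem vonNeumannEntropy_mul_diagonal_mul_conjTranspose (d : ℕ) {ι A : Type*} [Fintype ι]
    [Fintype A] [DecidableEq A] {V : Matrix ι A ℂ} (hV : Vᴴ * V = 1) (p : A → ℝ) :
    vonNeumannEntropy d (V * Matrix.diagonal (fun a => (p a : ℂ)) * Vᴴ) = shannonEntropy d p := by
  classical
  have hH : (V * Matrix.diagonal (fun a => (p a : ℂ)) * Vᴴ).IsHermitian :=
    Matrix.isHermitian_mul_mul_conjTranspose V <|
      Matrix.isHermitian_diagonal_iff.2 fun a => Complex.conj_ofReal (p a)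
  rw [vonNeumannEntropy, dif_pos hH, shannonEntropy, neg_inj]
  exact sum_eigenvalues_mul_diagonal_mul_conjTranspose (f := fun t => t * Real.logb d t) hV p hH
    (zero_mul _)

theorem vonNeumannEntropy_sum_isometry (d : ℕ) {ι S m : Type*} [Fintype ι] [Fintype S]
    [DecidableEq S] [Fintype m] [DecidableEq m] [Nonempty m] {V : S → Matrix ι m ℂ}
    (hV : ∀ s t, (V s)ᴴ * V t = if s = t then 1 else 0) {q : S → ℝ} (hq : ∑ s, q s = 1) :
    vonNeumannEntropy d ((Fintype.card m : ℂ)⁻¹ • ∑ s, (q s : ℂ) • (V s * (V s)ᴴ))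
      = shannonEntropy d q + Real.logb d (Fintype.card m) := by
  set W : Matrix ι (S × m) ℂ := Matrix.of fun i a => V a.1 i a.2
  have hW : Wᴴ * W = 1 := by
    ext ⟨s, i⟩ ⟨t, j⟩
    have hentry : (Wᴴ * W) (s, i) (t, j) = ((V s)ᴴ * V t) i j := rfl
    rw [hentry, hV]
    by_cases hst : s = t <;> simp [hst, Matrix.one_apply]
  have hdiag : (Fintype.card m : ℂ)⁻¹ • ∑ s, (q s : ℂ) • (V s * (V s)ᴴ)
      = W * Matrix.diagonal (fun a : S × m => ((q a.1 * (Fintype.card m : ℝ)⁻¹ : ℝ) : ℂ)) * Wᴴ := by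
    ext i j
    rw [Matrix.mul_apply, Fintype.sum_prod_type]
    simp only [Matrix.smul_apply, Matrix.sum_apply, smul_eq_mul, Matrix.mul_apply (M := V _),
      Matrix.mul_diagonal, Matrix.conjTranspose_apply, Matrix.of_apply, Finset.mul_sum, W]
    push_cast
    exact Finset.sum_congr rfl fun s _ => Finset.sum_congr rfl fun k _ => by ring
  rw [hdiag, vonNeumannEntropy_mul_diagonal_mul_conjTranspose d hW,
    shannonEntropy_mul (Q := q) (W := fun _ => (Fintype.card m : ℝ)⁻¹) d hq (by simp),
    shannonEntropy_const_inv_card]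

theorem vonNeumannEntropy_sum_isometry_of_fibers (d : ℕ) {ι X S m : Type*} [Fintype ι] [Fintype X]
    [Fintype S] [DecidableEq S] [Fintype m] [DecidableEq m] [Nonempty m] {V : X → Matrix ι m ℂ}
    {f : X → S} (hf : Function.Surjective f) (hV : ∀ x, (V x)ᴴ * V x = 1)
    (hsame : ∀ x y, f x = f y → V x * (V x)ᴴ = V y * (V y)ᴴ)
    (horth : ∀ x y, f x ≠ f y → (V x)ᴴ * V y = 0) {p : X → ℝ} (hp : ∑ x, p x = 1) :
    vonNeumannEntropy d ((Fintype.card m : ℂ)⁻¹ • ∑ x, (p x : ℂ) • (V x * (V x)ᴴ))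
      = shannonEntropy d (pushforward f p) + Real.logb d (Fintype.card m) := by
  obtain ⟨r, hr⟩ := hf.hasRightInverse
  have hVr : ∀ s t, (V (r s))ᴴ * V (r t) = if s = t then 1 else 0 := by
    intro s t
    split_ifs with hst
    · rw [hst, hV]
    · exact horth _ _ (by rwa [hr s, hr t])
  rw [← vonNeumannEntropy_sum_isometry d hVr ((sum_pushforward f p).trans hp),
    sum_pushforward_smul f p fun s => V (r s) * (V (r s))ᴴ]
  simp only [hsame _ _ (hr (f _))]

/-! ### Tensor powers and reference systems -/

section Channels

variable {ι κ : Type*} [Fintype ι] [Fintype κ]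

theorem tensorPower_krausMap [DecidableEq ι] (n : ℕ) (K : κ → Matrix ι ι ℂ) :
    tensorPower n (krausMap K)
      = krausMap fun x : Fin n → κ => Matrix.of fun a b => ∏ t, K (x t) (a t) (b t) := by
  have hsingle : ∀ i j a b : ι,
      krausMap K (Matrix.single i j 1) a b = ∑ u, K u a i * star (K u b j) := by
    intro i j a b
    simp [krausMap, Matrix.sum_apply, Matrix.mul_apply, Matrix.single_apply, ite_and]
  refine LinearMap.ext fun ρ => Matrix.ext fun a b => ?_
  simp only [tensorPower, hsingle, LinearMap.coe_mk, AddHom.coe_mk, Matrix.of_apply]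
  simp only [krausMap, LinearMap.coe_mk, AddHom.coe_mk, Matrix.of_apply,
    Finset.prod_univ_sum, Fintype.piFinset_univ, Matrix.sum_apply, Finset.mul_sum,
    Matrix.mul_apply, Matrix.conjTranspose_apply, Finset.sum_mul, Finset.prod_mul_distrib,
    star_prod]
  simp_rw [Finset.sum_comm (s := (Finset.univ : Finset (Fin n → ι)))
    (t := (Finset.univ : Finset (Fin n → κ)))]
  refine Finset.sum_congr rfl fun x _ => ?_
  rw [Finset.sum_comm]
  exact Finset.sum_congr rfl fun i _ => Finset.sum_congr rfl fun j _ => by ring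

theorem krausMap_sqrt_smul_apply {p : κ → ℝ} (hp : ∀ x, 0 ≤ p x) (K : κ → Matrix ι ι ℂ)
    (ρ : Matrix ι ι ℂ) :
    krausMap (fun x => ((√(p x) : ℝ) : ℂ) • K x) ρ = ∑ x, (p x : ℂ) • (K x * ρ * (K x)ᴴ) := by
  refine Finset.sum_congr rfl fun x _ => ?_
  rw [Matrix.conjTranspose_smul, Matrix.smul_mul, Matrix.smul_mul, Matrix.mul_smul, smul_smul,
    Complex.star_def, Complex.conj_ofReal, ← Complex.ofReal_mul, Real.mul_self_sqrt (hp x)]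

end Channels

section Purification

variable {ι κ R : Type*}

/-- The matrix of coefficients of a vector of a bipartite system: the reference system indexes the
columns, so that `Matrix.vec` is the inverse operation. -/
def coeffMatrix (Ψ : R × ι → ℂ) : Matrix ι R ℂ :=
  Matrix.of fun i r => Ψ (r, i)

theorem IsPurification.coeffMatrix_mul_conjTranspose [Fintype R] {Ψ : R × ι → ℂ}
    {ρ : Matrix ι ι ℂ} (hΨ : IsPurification Ψ ρ) : coeffMatrix Ψ * (coeffMatrix Ψ)ᴴ = ρ :=
  Matrix.ext hΨ

theorem idTensor_krausMap_sqrt_smul_ketBra [Fintype ι] [Fintype κ] {p : κ → ℝ}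
    (hp : ∀ x, 0 ≤ p x) (K : κ → Matrix ι ι ℂ) (Ψ : R × ι → ℂ) :
    idTensor R (krausMap fun x => ((√(p x) : ℝ) : ℂ) • K x) (ketBra Ψ)
      = ∑ x, (p x : ℂ) • ketBra (Matrix.vec (K x * coeffMatrix Ψ)) := by
  ext a b
  have hblock : (Matrix.of fun i j => ketBra Ψ (a.1, i) (b.1, j))
      = Matrix.vecMulVec (fun i => Ψ (a.1, i)) (star fun j => Ψ (b.1, j)) := rfl
  simp only [idTensor, LinearMap.coe_mk, AddHom.coe_mk, Matrix.of_apply, hblock,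
    krausMap_sqrt_smul_apply hp, Matrix.mul_vecMulVec, Matrix.vecMulVec_mul, ← Matrix.star_mulVec,
    Matrix.sum_apply, Matrix.smul_apply]
  rfl

end Purification

/-- The channel on `n` systems that applies `N_x` with probability `p x`; the errors on different
systems may be correlated. -/
noncomputable def weylChannel {d n : ℕ} [NeZero d] (ω : ℂ) (p : (Fin n → ZMod d × ZMod d) → ℝ) :
    Matrix (Fin n → ZMod d) (Fin n → ZMod d) ℂ →ₗ[ℂ] Matrix (Fin n → ZMod d) (Fin n → ZMod d) ℂ :=
  krausMap fun x => ((√(p x) : ℝ) : ℂ) • weylN ω x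

theorem tensorPower_pauliChannel {d n : ℕ} [NeZero d] (ω : ℂ) {P : ZMod d × ZMod d → ℝ}
    (hP : ∀ u, 0 ≤ P u) : tensorPower n (pauliChannel ω P) = weylChannel ω (prodDist P) := by
  rw [pauliChannel, tensorPower_krausMap, weylChannel]
  congr 1
  ext x a b
  simp [weylN, prodDist, Real.sqrt_prod _ fun t _ => hP (x t), Finset.prod_mul_distrib]

/-! ### Weyl operators -/

section Weyl

variable {d n : ℕ} [NeZero d] {ω : ℂ}

theorem zmodChar_sum (hω : ω ^ d = 1) {α : Type*} (s : Finset α) (f : α → ZMod d) :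
    AddChar.zmodChar d hω (∑ t ∈ s, f t) = ∏ t ∈ s, AddChar.zmodChar d hω (f t) :=
  map_prod (AddChar.zmodChar d hω).toMonoidHom (fun t => Multiplicative.ofAdd (f t)) s

theorem zmodChar_ne_one (hω : IsPrimitiveRoot ω d) {a : ZMod d} (ha : a ≠ 0) :
    AddChar.zmodChar d hω.pow_eq_one a ≠ 1 := by
  rw [AddChar.zmodChar_apply]
  exact hω.pow_ne_one_of_pos_of_lt ((ZMod.val_ne_zero a).2 ha) (ZMod.val_lt a)

theorem weylX_pow_apply (m : ℕ) (a b : ZMod d) :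
    (weylX d ^ m) a b = if a = b - m then 1 else 0 := by
  induction m generalizing a b with
  | zero => simp [Matrix.one_apply]
  | succ m ih =>
    have hX : ∀ c, weylX d c b = if c = b - 1 then 1 else 0 := fun c => rfl
    simp [pow_succ, Matrix.mul_apply, ih, hX, sub_sub, add_comm]

theorem weyl_apply (hω : ω ^ d = 1) (u : ZMod d × ZMod d) (a b : ZMod d) :
    weyl ω u a b = if a = b - u.1 then AddChar.zmodChar d hω (u.2 * b) else 0 := by
  have hphase : AddChar.zmodChar d hω (u.2 * b) = (ω ^ b.val) ^ u.2.val := by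
    rw [← pow_mul, ← AddChar.zmodChar_apply' hω]
    simp [mul_comm]
  rw [weyl, weylZ, Matrix.diagonal_pow, Matrix.mul_diagonal, weylX_pow_apply, hphase]
  simp

theorem weylN_apply (hω : ω ^ d = 1) (x : Fin n → ZMod d × ZMod d) (a b : Fin n → ZMod d) :
    weylN ω x a b = if a = b - Prod.fst ∘ x then
      AddChar.zmodChar d hω (∑ t, (x t).2 * b t) else 0 := by
  simp only [weylN, Matrix.of_apply, weyl_apply hω]
  rw [Finset.prod_ite_zero, zmodChar_sum]
  simp [funext_iff]

theorem weylN_zero (hω : ω ^ d = 1) : weylN ω (0 : Fin n → ZMod d × ZMod d) = 1 := by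
  ext a b
  simp [weylN_apply hω, Matrix.one_apply, funext_iff]

theorem weylN_mul (hω : ω ^ d = 1) (x y : Fin n → ZMod d × ZMod d) :
    weylN ω x * weylN ω y
      = AddChar.zmodChar d hω (-∑ t, (x t).2 * (y t).1) • weylN ω (x + y) := by
  ext a c
  rw [Matrix.mul_apply, Finset.sum_eq_single (c - Prod.fst ∘ y)
    (fun b _ hb => by rw [weylN_apply hω y, if_neg hb, mul_zero])
    fun h => absurd (Finset.mem_univ _) h]
  have hshift : c - Prod.fst ∘ y - Prod.fst ∘ x = c - Prod.fst ∘ (x + y) := by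
    ext t
    simp only [Pi.sub_apply, Function.comp_apply, Pi.add_apply, Prod.fst_add]
    ring
  have hphase : ∑ t, (x t).2 * (c - Prod.fst ∘ y) t + ∑ t, (y t).2 * c t
      = -∑ t, (x t).2 * (y t).1 + ∑ t, ((x + y) t).2 * c t := by
    simp only [← Finset.sum_neg_distrib, ← Finset.sum_add_distrib]
    refine Finset.sum_congr rfl fun t _ => ?_
    simp only [Pi.sub_apply, Function.comp_apply, Pi.add_apply, Prod.snd_add]
    ring
  simp only [weylN_apply hω, hshift, Matrix.smul_apply, smul_eq_mul, if_true]
  split_ifs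
  · rw [← AddChar.map_add_eq_mul, hphase, AddChar.map_add_eq_mul]
  · rw [zero_mul, mul_zero]

theorem weylN_mul_comm (hω : ω ^ d = 1) (x y : Fin n → ZMod d × ZMod d) :
    weylN ω x * weylN ω y = AddChar.zmodChar d hω (symp x y) • (weylN ω y * weylN ω x) := by
  have hphase : -∑ t, (x t).2 * (y t).1 = symp x y + -∑ t, (y t).2 * (x t).1 := by
    simp only [symp, ← Finset.sum_neg_distrib, ← Finset.sum_add_distrib]
    exact Finset.sum_congr rfl fun t _ => by ring
  rw [weylN_mul hω, weylN_mul hω, smul_smul, ← AddChar.map_add_eq_mul, add_comm y x, hphase]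

theorem conjTranspose_weylN (hω : ω ^ d = 1) (x : Fin n → ZMod d × ZMod d) :
    (weylN ω x)ᴴ = AddChar.zmodChar d hω (-∑ t, (x t).2 * (x t).1) • weylN ω (-x) := by
  ext a b
  have hiff : b = a - Prod.fst ∘ x ↔ a = b - Prod.fst ∘ (-x) := by
    rw [eq_sub_iff_add_eq, eq_sub_iff_add_eq, eq_comm, ← sub_eq_iff_eq_add, sub_eq_add_neg]
    rfl
  simp only [Matrix.conjTranspose_apply, weylN_apply hω, Matrix.smul_apply, smul_eq_mul, hiff]
  split_ifs with hab
  · rw [Complex.star_def, ← AddChar.map_neg_eq_conj, ← AddChar.map_add_eq_mul, hab]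
    congr 1
    simp only [← Finset.sum_neg_distrib, ← Finset.sum_add_distrib]
    refine Finset.sum_congr rfl fun t _ => ?_
    simp only [Pi.sub_apply, Pi.neg_apply, Function.comp_apply, Prod.fst_neg, Prod.snd_neg]
    ring
  · rw [star_zero, mul_zero]

theorem conjTranspose_weylN_mul_weylN (hω : ω ^ d = 1) (x y : Fin n → ZMod d × ZMod d) :
    (weylN ω x)ᴴ * weylN ω y
      = AddChar.zmodChar d hω (∑ t, (x t).2 * ((y t).1 - (x t).1)) • weylN ω (y - x) := by
  have hphase : -∑ t, (x t).2 * (x t).1 + -∑ t, ((-x) t).2 * (y t).1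
      = ∑ t, (x t).2 * ((y t).1 - (x t).1) := by
    simp only [← Finset.sum_neg_distrib, ← Finset.sum_add_distrib]
    refine Finset.sum_congr rfl fun t _ => ?_
    simp only [Pi.neg_apply, Prod.snd_neg]
    ring
  rw [conjTranspose_weylN hω, Matrix.smul_mul, weylN_mul hω, smul_smul, ← AddChar.map_add_eq_mul,
    hphase, neg_add_eq_sub]

theorem conjTranspose_weylN_mul_self (hω : ω ^ d = 1) (x : Fin n → ZMod d × ZMod d) :
    (weylN ω x)ᴴ * weylN ω x = 1 := by
  simp [conjTranspose_weylN_mul_weylN hω, weylN_zero hω]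

theorem weylN_mul_conjTranspose_self (hω : ω ^ d = 1) (x : Fin n → ZMod d × ZMod d) :
    weylN ω x * (weylN ω x)ᴴ = 1 :=
  mul_eq_one_comm.1 (conjTranspose_weylN_mul_self hω x)

theorem conjTranspose_weylN_mul_weylN_mul_weylN (hω : ω ^ d = 1)
    (x y : Fin n → ZMod d × ZMod d) :
    (weylN ω x)ᴴ * weylN ω y * weylN ω x = AddChar.zmodChar d hω (symp y x) • weylN ω y := by
  rw [Matrix.mul_assoc, weylN_mul_comm hω y x, Matrix.mul_smul, ← Matrix.mul_assoc,
    conjTranspose_weylN_mul_self hω, Matrix.one_mul]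

theorem exists_weylN_mul_weylN_sub (hω : ω ^ d = 1) (x y : Fin n → ZMod d × ZMod d) :
    ∃ c : ℂ, ‖c‖ = 1 ∧ weylN ω x = c • (weylN ω y * weylN ω (x - y)) := by
  refine ⟨AddChar.zmodChar d hω (∑ t, (y t).2 * ((x t).1 - (y t).1)), AddChar.norm_apply _ _, ?_⟩
  rw [← Matrix.mul_smul, ← conjTranspose_weylN_mul_weylN hω, ← Matrix.mul_assoc,
    weylN_mul_conjTranspose_self hω, Matrix.one_mul]

theorem weylN_mul_mul_conjTranspose_congr (hω : ω ^ d = 1)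
    {Q : Matrix (Fin n → ZMod d) (Fin n → ZMod d) ℂ} {x y : Fin n → ZMod d × ZMod d}
    (h : Commute (weylN ω (x - y)) Q) :
    weylN ω x * Q * (weylN ω x)ᴴ = weylN ω y * Q * (weylN ω y)ᴴ := by
  obtain ⟨c, hc, hx⟩ := exists_weylN_mul_weylN_sub hω x y
  have hphase : star c * c = 1 := by simp [Complex.conj_mul', hc]
  calc weylN ω x * Q * (weylN ω x)ᴴ
      = weylN ω y * (weylN ω (x - y) * Q) * (weylN ω (x - y))ᴴ * (weylN ω y)ᴴ := by
        simp only [hx, Matrix.conjTranspose_smul, Matrix.conjTranspose_mul, Matrix.smul_mul,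
          Matrix.mul_smul, smul_smul, hphase, one_smul, Matrix.mul_assoc]
    _ = weylN ω y * Q * (weylN ω (x - y) * (weylN ω (x - y))ᴴ) * (weylN ω y)ᴴ := by
        simp only [h.eq, Matrix.mul_assoc]
    _ = weylN ω y * Q * (weylN ω y)ᴴ := by
        rw [weylN_mul_conjTranspose_self hω, Matrix.mul_one]

end Weyl

/-! ### Hyperbolic bases and cosets -/

section Symplectic

variable {d n k : ℕ}

theorem symp_swap (x y : Fin n → ZMod d × ZMod d) : symp y x = -symp x y := by
  simp only [symp, ← Finset.sum_neg_distrib]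
  exact Finset.sum_congr rfl fun t _ => by ring

theorem symp_add_right (x y z : Fin n → ZMod d × ZMod d) :
    symp x (y + z) = symp x y + symp x z := by
  simp only [symp, ← Finset.sum_add_distrib, Pi.add_apply, Prod.fst_add, Prod.snd_add]
  exact Finset.sum_congr rfl fun t _ => by ring

theorem symp_smul_right (c : ZMod d) (x y : Fin n → ZMod d × ZMod d) :
    symp x (c • y) = c • symp x y := by
  simp only [symp, Finset.mul_sum, Pi.smul_apply, Prod.smul_fst, Prod.smul_snd, smul_eq_mul]
  exact Finset.sum_congr rfl fun t _ => by ring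

/-- The symplectic form `symp` as a bilinear map. -/
def sympForm (d n : ℕ) : LinearMap.BilinForm (ZMod d) (Fin n → ZMod d × ZMod d) :=
  LinearMap.mk₂ (ZMod d) symp
    (fun x y z => by rw [symp_swap, symp_add_right, neg_add, ← symp_swap, ← symp_swap])
    (fun c x y => by rw [symp_swap, symp_smul_right, ← smul_neg, ← symp_swap])
    symp_add_right symp_smul_right

theorem sympForm_apply (x y : Fin n → ZMod d × ZMod d) : sympForm d n x y = symp x y :=
  rfl

theorem neg_mem_perp {L : Submodule (ZMod d) (Fin n → ZMod d × ZMod d)}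
    {z : Fin n → ZMod d × ZMod d} (hz : z ∈ perp L) : -z ∈ perp L := fun x hx => by
  rw [← sympForm_apply, map_neg, sympForm_apply, hz x hx, neg_zero]

variable {g h : Fin n → (Fin n → ZMod d × ZMod d)}

theorem IsHyperbolic.symp_fst_sum (hgh : IsHyperbolic g h) (w z : Fin n → ZMod d) (j : Fin n) :
    symp (g j) (∑ i, (w i • g i + z i • h i)) = z j := by
  rw [← sympForm_apply]
  simp only [map_sum, map_add, map_smul]
  simp [sympForm_apply, (hgh j _).1, (hgh j _).2.1]

theorem IsHyperbolic.symp_sum_snd (hgh : IsHyperbolic g h) (w z : Fin n → ZMod d) (j : Fin n) :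
    symp (∑ i, (w i • g i + z i • h i)) (h j) = w j := by
  rw [← sympForm_apply]
  simp [sympForm_apply, (hgh _ j).1, (hgh _ j).2.2]

theorem IsHyperbolic.eq_sum [NeZero d] (hgh : IsHyperbolic g h) (x : Fin n → ZMod d × ZMod d) :
    x = ∑ i, (symp x (h i) • g i + symp (g i) x • h i) := by
  let coords (wz : (Fin n → ZMod d) × (Fin n → ZMod d)) : Fin n → ZMod d × ZMod d :=
    ∑ i, (wz.1 i • g i + wz.2 i • h i)
  have hinj : Function.Injective coords :=
    Function.LeftInverse.injective
      (g := fun x => (fun j => symp x (h j), fun j => symp (g j) x)) fun wz =>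
        Prod.ext (funext (hgh.symp_sum_snd wz.1 wz.2)) (funext (hgh.symp_fst_sum wz.1 wz.2))
  have hbij := (Fintype.bijective_iff_injective_and_card coords).2 ⟨hinj, by simp [mul_pow]⟩
  obtain ⟨⟨w, z⟩, rfl⟩ := hbij.2 x
  simp only [coords, hgh.symp_sum_snd, hgh.symp_fst_sum]

/-- The span of the first `n - k` vectors of `g`. -/
def lowSpan (k : ℕ) (g : Fin n → (Fin n → ZMod d × ZMod d)) :
    Submodule (ZMod d) (Fin n → ZMod d × ZMod d) :=
  Submodule.span (ZMod d) (Set.range fun i : Fin (n - k) => g (lowIdx k i))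

/-- The row index of an error `x` in the array `cosetDist`: the values `⟨g_i, x⟩` for `i ≤ n - k`,
which are the coordinates `z_i` of `x`. -/
def syndrome (k : ℕ) (g : Fin n → (Fin n → ZMod d × ZMod d)) :
    (Fin n → ZMod d × ZMod d) →ₗ[ZMod d] (Fin (n - k) → ZMod d) :=
  LinearMap.pi fun i => sympForm d n (g (lowIdx k i))

/-- The column index of an error `x` in the array `cosetDist`: the coordinates
`(w_i, z_i) = (⟨x, h_i⟩, ⟨g_i, x⟩)` of `x` for `i > n - k`. -/
def logicalIndex (hk : k ≤ n) (g h : Fin n → (Fin n → ZMod d × ZMod d)) :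
    (Fin n → ZMod d × ZMod d) →ₗ[ZMod d] (Fin k → ZMod d × ZMod d) :=
  LinearMap.pi fun i =>
    ((sympForm d n).flip (h (highIdx hk i))).prod (sympForm d n (g (highIdx hk i)))

/-- The position of an error in the array `cosetDist`; its fibres are the cosets of `lowSpan k g`,
just as the fibres of `syndrome` are the cosets of the orthogonal complement. -/
def cosetIndex (hk : k ≤ n) (g h : Fin n → (Fin n → ZMod d × ZMod d)) :
    (Fin n → ZMod d × ZMod d) →ₗ[ZMod d] (Fin (n - k) → ZMod d) × (Fin k → ZMod d × ZMod d) :=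
  (syndrome k g).prod (logicalIndex hk g h)

theorem syndrome_eq_iff {x : Fin n → ZMod d × ZMod d} {s : Fin (n - k) → ZMod d} :
    syndrome k g x = s ↔ ∀ i, symp (g (lowIdx k i)) x = s i :=
  funext_iff

theorem logicalIndex_eq_iff {hk : k ≤ n} {x : Fin n → ZMod d × ZMod d}
    {u : Fin k → ZMod d × ZMod d} : logicalIndex hk g h x = u ↔
      ∀ i, symp x (h (highIdx hk i)) = (u i).1 ∧ symp (g (highIdx hk i)) x = (u i).2 := by
  simp only [funext_iff, Prod.ext_iff]
  rfl

theorem IsHyperbolic.cosetIndex_sum (hgh : IsHyperbolic g h) (hk : k ≤ n) (w z : Fin n → ZMod d) :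
    cosetIndex hk g h (∑ i, (w i • g i + z i • h i))
      = (fun i => z (lowIdx k i), fun i => (w (highIdx hk i), z (highIdx hk i))) :=
  Prod.ext (syndrome_eq_iff.2 fun _ => hgh.symp_fst_sum w z _) <|
    logicalIndex_eq_iff.2 fun _ => ⟨hgh.symp_sum_snd w z _, hgh.symp_fst_sum w z _⟩

theorem IsHyperbolic.cosetIndex_surjective (hgh : IsHyperbolic g h) (hk : k ≤ n) :
    Function.Surjective (cosetIndex hk g h) := by
  rintro ⟨s, u⟩
  let w : Fin n → ZMod d := fun j =>
    if hj : (j : ℕ) < n - k then 0 else (u ⟨j - (n - k), by omega⟩).1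
  let z : Fin n → ZMod d := fun j =>
    if hj : (j : ℕ) < n - k then s ⟨j, hj⟩ else (u ⟨j - (n - k), by omega⟩).2
  refine ⟨∑ i, (w i • g i + z i • h i), ?_⟩
  rw [hgh.cosetIndex_sum]
  simp [w, z, lowIdx, highIdx]

theorem lowIdx_or_highIdx (hk : k ≤ n) (i : Fin n) :
    (∃ j, i = lowIdx k j) ∨ ∃ j, i = highIdx hk j := by
  by_cases hi : (i : ℕ) < n - k
  · exact .inl ⟨⟨i, hi⟩, rfl⟩
  · refine .inr ⟨⟨i - (n - k), by omega⟩, Fin.ext ?_⟩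
    simp only [highIdx]
    omega

theorem lowIdx_ne_highIdx (hk : k ≤ n) (i : Fin (n - k)) (j : Fin k) :
    lowIdx k i ≠ highIdx hk j := by
  simp only [lowIdx, highIdx, ne_eq, Fin.mk.injEq]
  omega

theorem mem_ker_syndrome {x : Fin n → ZMod d × ZMod d} :
    x ∈ LinearMap.ker (syndrome k g) ↔ x ∈ perp (lowSpan k g) := by
  have hperp : x ∈ perp (lowSpan k g) ↔
      lowSpan k g ≤ LinearMap.ker ((sympForm d n).flip x) := Iff.rfl
  rw [hperp, lowSpan, Submodule.span_le, Set.range_subset_iff, LinearMap.mem_ker, syndrome_eq_iff]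
  rfl

theorem IsHyperbolic.fst_mem_perp_lowSpan (hgh : IsHyperbolic g h) (j : Fin n) :
    g j ∈ perp (lowSpan k g) :=
  mem_ker_syndrome.1 <| syndrome_eq_iff.2 fun _ => (hgh _ j).2.1

theorem IsHyperbolic.snd_highIdx_mem_perp_lowSpan (hgh : IsHyperbolic g h) (hk : k ≤ n)
    (j : Fin k) : h (highIdx hk j) ∈ perp (lowSpan k g) :=
  mem_ker_syndrome.1 <| syndrome_eq_iff.2 fun i =>
    (hgh _ _).1.trans (if_neg (lowIdx_ne_highIdx hk i j))

theorem IsHyperbolic.cosetIndex_eq_zero_of_perp_perp (hgh : IsHyperbolic g h) (hk : k ≤ n)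
    {x : Fin n → ZMod d × ZMod d} (hx : ∀ z ∈ perp (lowSpan k g), symp z x = 0) :
    cosetIndex hk g h x = 0 :=
  Prod.ext (syndrome_eq_iff.2 fun _ => hx _ (hgh.fst_mem_perp_lowSpan _)) <|
    logicalIndex_eq_iff.2 fun j =>
      ⟨by rw [symp_swap, hx _ (hgh.snd_highIdx_mem_perp_lowSpan hk j)]; exact neg_zero,
        hx _ (hgh.fst_mem_perp_lowSpan _)⟩

variable [NeZero d]

theorem IsHyperbolic.mem_lowSpan_of_cosetIndex_eq_zero (hgh : IsHyperbolic g h) {hk : k ≤ n}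
    {x : Fin n → ZMod d × ZMod d} (hx : cosetIndex hk g h x = 0) : x ∈ lowSpan k g := by
  have hlow := syndrome_eq_iff.1 (congrArg Prod.fst hx)
  have hhigh := logicalIndex_eq_iff.1 (congrArg Prod.snd hx)
  rw [hgh.eq_sum x]
  refine Submodule.sum_mem _ fun i _ => ?_
  rcases lowIdx_or_highIdx hk i with ⟨j, rfl⟩ | ⟨j, rfl⟩
  · simp only [hlow j, Prod.fst_zero, Pi.zero_apply, zero_smul, add_zero]
    exact Submodule.smul_mem _ _ (Submodule.subset_span ⟨j, rfl⟩)
  · simp [hhigh j]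

theorem IsHyperbolic.mem_lowSpan_of_perp_perp (hgh : IsHyperbolic g h) (hk : k ≤ n)
    {x : Fin n → ZMod d × ZMod d} (hx : ∀ z ∈ perp (lowSpan k g), symp z x = 0) :
    x ∈ lowSpan k g :=
  hgh.mem_lowSpan_of_cosetIndex_eq_zero (hgh.cosetIndex_eq_zero_of_perp_perp hk hx)

theorem IsHyperbolic.ker_cosetIndex (hgh : IsHyperbolic g h) (hk : k ≤ n) :
    LinearMap.ker (cosetIndex hk g h) = lowSpan k g :=
  le_antisymm (fun _ => hgh.mem_lowSpan_of_cosetIndex_eq_zero) fun x hx =>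
    hgh.cosetIndex_eq_zero_of_perp_perp hk fun z hz => by rw [symp_swap, hz x hx, neg_zero]

theorem IsHyperbolic.cosetDist_eq_pushforward (hgh : IsHyperbolic g h) (hk : k ≤ n)
    (P : ZMod d × ZMod d → ℝ) :
    cosetDist hk g h P = pushforward (cosetIndex hk g h) (prodDist P) := by
  funext su
  unfold cosetDist pushforward
  congr 1
  ext x
  simp only [Finset.mem_filter, Finset.mem_univ, true_and]
  constructor
  · rintro ⟨w, z, rfl, hs, hu⟩
    rw [hgh.cosetIndex_sum]
    exact Prod.ext (funext hs) (funext fun i => Prod.ext (hu i).1 (hu i).2)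
  · rintro rfl
    exact ⟨_, _, hgh.eq_sum x, fun i => rfl, fun i => ⟨rfl, rfl⟩⟩

theorem IsHyperbolic.marginal_cosetDist (hgh : IsHyperbolic g h) (hk : k ≤ n)
    (P : ZMod d × ZMod d → ℝ) :
    marginal (cosetDist hk g h P) = pushforward (syndrome k g) (prodDist P) := by
  rw [hgh.cosetDist_eq_pushforward, marginal_pushforward]
  rfl

end Symplectic

/-! ### Projections onto codes -/

section Projection

variable {ι : Type*} [Fintype ι]

open scoped ComplexOrder in
theorem mul_eq_smul_of_mul_self_mul_conjTranspose {m : Type*} [Fintype m] {U : Matrix ι ι ℂ}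
    {M : Matrix ι m ℂ} {c : ℂ} (h : U * (M * Mᴴ) = c • (M * Mᴴ)) : U * M = c • M := by
  classical
  have hzero : (U - c • 1) * (M * Mᴴ) = 0 := by
    rw [Matrix.sub_mul, h, Matrix.smul_mul, Matrix.one_mul, sub_self]
  rwa [Matrix.mul_self_mul_conjTranspose_eq_zero, Matrix.sub_mul, Matrix.smul_mul, Matrix.one_mul,
    sub_eq_zero] at hzero

variable [DecidableEq ι]

open scoped ComplexOrder in
theorem norm_eq_one_of_mul_eq_smul {m : Type*} {U : Matrix ι ι ℂ} (hU : Uᴴ * U = 1)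
    {M : Matrix ι m ℂ} (hM : M ≠ 0) {c : ℂ} (h : U * M = c • M) : ‖c‖ = 1 := by
  have hgram : (star c * c) • (Mᴴ * M) = (1 : ℂ) • (Mᴴ * M) := by
    rw [mul_smul, ← Matrix.mul_smul, ← Matrix.smul_mul, ← Matrix.conjTranspose_smul, ← h,
      Matrix.conjTranspose_mul, Matrix.mul_assoc, ← Matrix.mul_assoc Uᴴ, hU, Matrix.one_mul,
      one_smul]
  have hc := smul_left_injective ℂ (Matrix.conjTranspose_mul_self_eq_zero.not.2 hM) hgram
  rw [Complex.star_def, Complex.conj_mul'] at hc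
  exact (pow_eq_one_iff_of_nonneg (norm_nonneg c) two_ne_zero).1 (mod_cast hc)

variable (C : Submodule ℂ (EuclideanSpace ℂ ι))

theorem exists_projMatrix_eq_mul_conjTranspose :
    ∃ B : Matrix ι (Fin (Module.finrank ℂ C)) ℂ, Bᴴ * B = 1 ∧ projMatrix C = B * Bᴴ := by
  set b := stdOrthonormalBasis ℂ C
  refine ⟨Matrix.of fun i j => (b j : EuclideanSpace ℂ ι) i, ?_, ?_⟩
  · ext i j
    have hij := orthonormal_iff_ite.1 b.orthonormal i j
    rw [Submodule.coe_inner, EuclideanSpace.inner_eq_star_dotProduct] at hij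
    rw [Matrix.one_apply, ← hij, dotProduct_comm]
    rfl
  · rw [projMatrix, b.starProjection_eq_sum_rankOne]
    ext i j
    simp [Matrix.mul_apply, Matrix.sum_apply, InnerProductSpace.symm_toEuclideanLin_rankOne,
      Matrix.vecMulVec_apply]

theorem isHermitian_projMatrix : (projMatrix C).IsHermitian := by
  obtain ⟨B, -, hB⟩ := exists_projMatrix_eq_mul_conjTranspose C
  exact hB ▸ Matrix.isHermitian_mul_conjTranspose_self B

theorem projMatrix_mul_self : projMatrix C * projMatrix C = projMatrix C := by
  obtain ⟨B, hBB, hB⟩ := exists_projMatrix_eq_mul_conjTranspose C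
  rw [hB, Matrix.mul_assoc, ← Matrix.mul_assoc Bᴴ, hBB, Matrix.one_mul]

open scoped ComplexOrder in
theorem posSemidef_maxMixed : (maxMixed C).PosSemidef := by
  obtain ⟨B, -, hB⟩ := exists_projMatrix_eq_mul_conjTranspose C
  rw [maxMixed, hB]
  exact (Matrix.posSemidef_self_mul_conjTranspose B).smul (inv_nonneg.2 (Nat.cast_nonneg _))

variable {C}

theorem projMatrix_mul_eq_self_iff {m : Type*} {M : Matrix ι m ℂ} :
    projMatrix C * M = M ↔ ∀ j, WithLp.toLp 2 (fun i => M i j) ∈ C := by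
  have hcol : ∀ j, WithLp.toLp 2 (fun i => (projMatrix C * M) i j)
      = C.starProjection (WithLp.toLp 2 fun i => M i j) := fun j => by
    rw [← ContinuousLinearMap.coe_coe, ← Matrix.toEuclideanLin.apply_symm_apply
      (C.starProjection : EuclideanSpace ℂ ι →ₗ[ℂ] EuclideanSpace ℂ ι)]
    rfl
  simp only [← Submodule.starProjection_eq_self_iff, ← hcol,
    (WithLp.toLp_injective 2).eq_iff, funext_iff, ← Matrix.ext_iff]
  exact forall_comm

theorem trace_maxMixed (hC : Module.finrank ℂ C ≠ 0) : (maxMixed C).trace = 1 := by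
  obtain ⟨B, hBB, hB⟩ := exists_projMatrix_eq_mul_conjTranspose C
  rw [maxMixed, hB, Matrix.trace_smul, Matrix.trace_mul_comm, hBB, Matrix.trace_one,
    Fintype.card_fin, smul_eq_mul, inv_mul_cancel₀ (Nat.cast_ne_zero.2 hC)]

end Projection

/-! ### Symplectic codes -/

section Code

variable {d n k : ℕ} [NeZero d] {ω : ℂ} {L : Submodule (ZMod d) (Fin n → ZMod d × ZMod d)}
  {C : Submodule ℂ (EuclideanSpace ℂ (Fin n → ZMod d))}

theorem IsSymplecticCode.finrank_ne_zero (hC : IsSymplecticCode ω k L C) :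
    Module.finrank ℂ C ≠ 0 :=
  hC.1 ▸ pow_ne_zero k (NeZero.ne d)

theorem IsSymplecticCode.exists_projMatrix_mul_eq_self_iff (hC : IsSymplecticCode ω k L C) :
    ∃ τ : (Fin n → ZMod d × ZMod d) → ℂ, ∀ M : Matrix (Fin n → ZMod d) (Fin n → ZMod d) ℂ,
      projMatrix C * M = M ↔ ∀ x ∈ L, weylN ω x * M = τ x • M := by
  obtain ⟨-, τ, hτ⟩ := hC
  refine ⟨fun x => τ (weylN ω x), fun M => projMatrix_mul_eq_self_iff.trans ⟨fun h x hx => ?_,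
    fun h j => (hτ _).2 ?_⟩⟩
  · ext i j
    exact congrFun (congrArg WithLp.ofLp ((hτ _).1 (h j) _ ⟨x, hx, rfl⟩)) i
  · rintro _ ⟨x, hx, rfl⟩
    exact WithLp.ofLp_injective 2 (funext fun i => congrFun (congrFun (h x hx) i) j)

theorem IsSymplecticCode.exists_weylN_mul_projMatrix (hω : ω ^ d = 1)
    (hC : IsSymplecticCode ω k L C) {x : Fin n → ZMod d × ZMod d} (hx : x ∈ L) :
    ∃ c : ℂ, ‖c‖ = 1 ∧ weylN ω x * projMatrix C = c • projMatrix C := by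
  obtain ⟨τ, hτ⟩ := hC.exists_projMatrix_mul_eq_self_iff
  have heigen := (hτ _).1 (projMatrix_mul_self C) x hx
  have hne : projMatrix C ≠ 0 := fun h => by
    simpa [maxMixed, h] using trace_maxMixed hC.finrank_ne_zero
  exact ⟨τ x, norm_eq_one_of_mul_eq_smul (conjTranspose_weylN_mul_self hω x) hne heigen, heigen⟩

theorem IsSymplecticCode.projMatrix_mul_weylN_mul_projMatrix (hω : ω ^ d = 1)
    (hC : IsSymplecticCode ω k L C) {z : Fin n → ZMod d × ZMod d} (hz : z ∈ perp L) :
    projMatrix C * (weylN ω z * projMatrix C) = weylN ω z * projMatrix C := by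
  obtain ⟨τ, hτ⟩ := hC.exists_projMatrix_mul_eq_self_iff
  refine (hτ _).2 fun x hx => ?_
  rw [← Matrix.mul_assoc, weylN_mul_comm hω, hz x hx, AddChar.map_zero_eq_one, one_smul,
    Matrix.mul_assoc, (hτ _).1 (projMatrix_mul_self C) x hx, Matrix.mul_smul]

theorem IsSymplecticCode.commute_weylN_projMatrix (hω : ω ^ d = 1)
    (hC : IsSymplecticCode ω k L C) {z : Fin n → ZMod d × ZMod d} (hz : z ∈ perp L) :
    Commute (weylN ω z) (projMatrix C) := by
  have hadj : projMatrix C * ((weylN ω z)ᴴ * projMatrix C) = (weylN ω z)ᴴ * projMatrix C := by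
    rw [conjTranspose_weylN hω, Matrix.smul_mul, Matrix.mul_smul,
      hC.projMatrix_mul_weylN_mul_projMatrix hω (neg_mem_perp hz)]
  replace hadj := congrArg Matrix.conjTranspose hadj
  simp only [Matrix.conjTranspose_mul, Matrix.conjTranspose_conjTranspose,
    (isHermitian_projMatrix C).eq, Matrix.mul_assoc,
    hC.projMatrix_mul_weylN_mul_projMatrix hω hz] at hadj
  exact hadj

theorem conjTranspose_mul_weylN_mul_eq_zero (hω : IsPrimitiveRoot ω d) {m : Type*}
    {M : Matrix (Fin n → ZMod d) m ℂ} {x y : Fin n → ZMod d × ZMod d} {c : ℂ} (hc : ‖c‖ = 1)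
    (hx : weylN ω x * M = c • M) (hxy : symp x y ≠ 0) : Mᴴ * (weylN ω y * M) = 0 := by
  have hphase : star c * c = 1 := by simp [Complex.conj_mul', hc]
  have hfix : AddChar.zmodChar d hω.pow_eq_one (symp y x) • (Mᴴ * (weylN ω y * M))
      = (1 : ℂ) • (Mᴴ * (weylN ω y * M)) :=
    calc _ = Mᴴ * ((weylN ω x)ᴴ * weylN ω y * weylN ω x * M) := by
          rw [conjTranspose_weylN_mul_weylN_mul_weylN hω.pow_eq_one, Matrix.smul_mul,
            Matrix.mul_smul]
      _ = (weylN ω x * M)ᴴ * (weylN ω y * (weylN ω x * M)) := by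
          simp only [Matrix.conjTranspose_mul, Matrix.mul_assoc]
      _ = _ := by
          rw [hx, Matrix.conjTranspose_smul, Matrix.smul_mul, Matrix.mul_smul, Matrix.mul_smul,
            smul_smul, hphase]
  by_contra hne
  exact zmodChar_ne_one hω (symp_swap x y ▸ neg_ne_zero.2 hxy) (smul_left_injective ℂ hne hfix)

theorem trace_weylN_mul_eq_zero (hω : IsPrimitiveRoot ω d)
    {Q : Matrix (Fin n → ZMod d) (Fin n → ZMod d) ℂ} {x y : Fin n → ZMod d × ZMod d}
    (hx : Commute (weylN ω x) Q) (hxy : symp x y ≠ 0) : (weylN ω y * Q).trace = 0 := by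
  have hfix : AddChar.zmodChar d hω.pow_eq_one (symp y x) • (weylN ω y * Q).trace
      = (1 : ℂ) • (weylN ω y * Q).trace :=
    calc _ = ((weylN ω x)ᴴ * weylN ω y * weylN ω x * Q).trace := by
          rw [conjTranspose_weylN_mul_weylN_mul_weylN hω.pow_eq_one, Matrix.smul_mul,
            Matrix.trace_smul]
      _ = ((weylN ω x)ᴴ * (weylN ω y * Q * weylN ω x)).trace := by
          simp only [Matrix.mul_assoc, hx.eq]
      _ = _ := by
          rw [Matrix.trace_mul_comm, Matrix.mul_assoc, weylN_mul_conjTranspose_self hω.pow_eq_one,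
            Matrix.mul_one, one_smul]
  by_contra hne
  exact zmodChar_ne_one hω (symp_swap x y ▸ neg_ne_zero.2 hxy) (smul_left_injective ℂ hne hfix)

end Code

/-! ### Entropies at the output of a Weyl channel -/

section Vec

variable {ι κ : Type*}

theorem smul_mul_conjTranspose_smul [Fintype κ] {c : ℂ} (hc : ‖c‖ = 1)
    (M : Matrix ι κ ℂ) : c • M * (c • M)ᴴ = M * Mᴴ := by
  rw [Matrix.conjTranspose_smul, Matrix.smul_mul, Matrix.mul_smul, smul_smul, Complex.star_def,
    Complex.mul_conj', hc]
  simp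

theorem ketBra_eq_replicateCol_mul_conjTranspose (v : ι → ℂ) :
    ketBra v = Matrix.replicateCol Unit v * (Matrix.replicateCol Unit v)ᴴ := by
  rw [ketBra, Matrix.vecMulVec_eq Unit, Matrix.conjTranspose_replicateCol]

theorem conjTranspose_replicateCol_vec_mul_replicateCol_vec [Fintype ι] [Fintype κ]
    (U W : Matrix ι ι ℂ) (A : Matrix ι κ ℂ) :
    (Matrix.replicateCol Unit (Matrix.vec (U * A)))ᴴ
        * Matrix.replicateCol Unit (Matrix.vec (W * A))
      = Matrix.of fun _ _ => (Uᴴ * W * (A * Aᴴ)).trace := by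
  ext
  rw [Matrix.conjTranspose_replicateCol, Matrix.replicateRow_mul_replicateCol_apply,
    Matrix.star_vec_dotProduct_vec, Matrix.of_apply, ← Matrix.mul_assoc,
    Matrix.trace_mul_comm, Matrix.conjTranspose_mul, Matrix.mul_assoc, ← Matrix.mul_assoc,
    Matrix.trace_mul_comm]

end Vec

section Entropy

variable {d n k : ℕ} [NeZero d] {ω : ℂ} {L : Submodule (ZMod d) (Fin n → ZMod d × ZMod d)}
  {C : Submodule ℂ (EuclideanSpace ℂ (Fin n → ZMod d))} {p : (Fin n → ZMod d × ZMod d) → ℝ}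
  {S : Type*} [AddCommGroup S] [Module (ZMod d) S] [Fintype S] [DecidableEq S]
  {f : (Fin n → ZMod d × ZMod d) →ₗ[ZMod d] S}

theorem IsSymplecticCode.vonNeumannEntropy_weylChannel_maxMixed (hd : 1 < d)
    (hω : IsPrimitiveRoot ω d) (hC : IsSymplecticCode ω k L C) (hp : IsProbDist p)
    (hf : Function.Surjective f) (hker : ∀ x, x ∈ LinearMap.ker f ↔ x ∈ perp L) :
    vonNeumannEntropy d (weylChannel ω p (maxMixed C))
      = shannonEntropy d (pushforward f p) + k := by
  obtain ⟨B, hBB, hB⟩ := exists_projMatrix_eq_mul_conjTranspose C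
  have hsandwich (x : Fin n → ZMod d × ZMod d) : weylN ω x * B * (weylN ω x * B)ᴴ
      = weylN ω x * projMatrix C * (weylN ω x)ᴴ := by
    simp only [hB, Matrix.conjTranspose_mul, Matrix.mul_assoc]
  have hisometry (x : Fin n → ZMod d × ZMod d) : (weylN ω x * B)ᴴ * (weylN ω x * B) = 1 := by
    rw [Matrix.conjTranspose_mul, Matrix.mul_assoc, ← Matrix.mul_assoc _ _ B,
      conjTranspose_weylN_mul_self hω.pow_eq_one, Matrix.one_mul, hBB]
  have hsame (x y : Fin n → ZMod d × ZMod d) (hxy : f x = f y) :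
      weylN ω x * B * (weylN ω x * B)ᴴ = weylN ω y * B * (weylN ω y * B)ᴴ := by
    rw [hsandwich, hsandwich]
    exact weylN_mul_mul_conjTranspose_congr hω.pow_eq_one
      (hC.commute_weylN_projMatrix hω.pow_eq_one <| (hker _).1 <|
        LinearMap.sub_mem_ker_iff.2 hxy)
  have horth (x y : Fin n → ZMod d × ZMod d) (hxy : f x ≠ f y) :
      (weylN ω x * B)ᴴ * (weylN ω y * B) = 0 := by
    obtain ⟨z, hz, hsymp⟩ : ∃ z ∈ L, symp z (y - x) ≠ 0 := by
      by_contra! h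
      exact hxy (LinearMap.sub_mem_ker_iff.1 ((hker _).2 h)).symm
    obtain ⟨c, hc, hcz⟩ := hC.exists_weylN_mul_projMatrix hω.pow_eq_one hz
    have hcB : weylN ω z * B = c • B :=
      mul_eq_smul_of_mul_self_mul_conjTranspose (hB ▸ hcz)
    rw [Matrix.conjTranspose_mul, Matrix.mul_assoc, ← Matrix.mul_assoc _ _ B,
      conjTranspose_weylN_mul_weylN hω.pow_eq_one, Matrix.smul_mul, Matrix.mul_smul,
      conjTranspose_mul_weylN_mul_eq_zero hω hc hcB hsymp, smul_zero]
  have : NeZero (Module.finrank ℂ C) := ⟨hC.finrank_ne_zero⟩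
  have hentropy := vonNeumannEntropy_sum_isometry_of_fibers d hf hisometry hsame horth hp.2
  have hchannel : weylChannel ω p (maxMixed C) = (Fintype.card (Fin (Module.finrank ℂ C)) : ℂ)⁻¹ •
      ∑ x, (p x : ℂ) • (weylN ω x * B * (weylN ω x * B)ᴴ) := by
    rw [maxMixed, map_smul, weylChannel, krausMap_sqrt_smul_apply hp.1, Fintype.card_fin]
    simp only [hsandwich]
  rw [hchannel, hentropy, Fintype.card_fin, hC.1, Nat.cast_pow, Real.logb_pow,
    Real.logb_self_eq_one (by exact_mod_cast hd), mul_one]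

theorem IsSymplecticCode.exists_weylN_mul_eq_smul_weylN_mul (hω : ω ^ d = 1)
    (hC : IsSymplecticCode ω k L C) {m : Type*} [Fintype m] {A : Matrix (Fin n → ZMod d) m ℂ}
    (hA : A * Aᴴ = maxMixed C) {x y : Fin n → ZMod d × ZMod d} (hxy : x - y ∈ L) :
    ∃ c : ℂ, ‖c‖ = 1 ∧ weylN ω x * A = c • (weylN ω y * A) := by
  obtain ⟨b, hb, hbxy⟩ := exists_weylN_mul_weylN_sub hω x y
  obtain ⟨c, hc, hcproj⟩ := hC.exists_weylN_mul_projMatrix hω hxy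
  have heigen : weylN ω (x - y) * A = c • A :=
    mul_eq_smul_of_mul_self_mul_conjTranspose <| by
      rw [hA, maxMixed, Matrix.mul_smul, hcproj, smul_comm]
  refine ⟨b * c, by rw [norm_mul, hb, hc, mul_one], ?_⟩
  rw [hbxy, Matrix.smul_mul, Matrix.mul_assoc, heigen, Matrix.mul_smul, smul_smul]

theorem IsSymplecticCode.vonNeumannEntropy_idTensor_weylChannel_ketBra {R : Type*} [Fintype R]
    (hω : IsPrimitiveRoot ω d) (hC : IsSymplecticCode ω k L C) (hp : IsProbDist p)
    (hf : Function.Surjective f) (hker : LinearMap.ker f = L)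
    (hperp : ∀ x, (∀ z ∈ perp L, symp z x = 0) → x ∈ L)
    {Ψ : R × (Fin n → ZMod d) → ℂ} (hΨ : IsPurification Ψ (maxMixed C)) :
    vonNeumannEntropy d (idTensor R (weylChannel ω p) (ketBra Ψ))
      = shannonEntropy d (pushforward f p) := by
  set A := coeffMatrix Ψ
  have hA : A * Aᴴ = maxMixed C := hΨ.coeffMatrix_mul_conjTranspose
  let V (x : Fin n → ZMod d × ZMod d) := Matrix.replicateCol Unit (Matrix.vec (weylN ω x * A))
  have hisometry (x : Fin n → ZMod d × ZMod d) : (V x)ᴴ * V x = 1 := by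
    rw [conjTranspose_replicateCol_vec_mul_replicateCol_vec,
      conjTranspose_weylN_mul_self hω.pow_eq_one, Matrix.one_mul, hA,
      trace_maxMixed hC.finrank_ne_zero]
    ext
    simp
  have hsame (x y : Fin n → ZMod d × ZMod d) (hxy : f x = f y) : V x * (V x)ᴴ = V y * (V y)ᴴ := by
    obtain ⟨c, hc, hcA⟩ := hC.exists_weylN_mul_eq_smul_weylN_mul hω.pow_eq_one hA
      (hker ▸ LinearMap.sub_mem_ker_iff.2 hxy : x - y ∈ L)
    have hV : V x = c • V y := by
      simp only [V, hcA, Matrix.vec_smul, Matrix.replicateCol_smul]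
    rw [hV, smul_mul_conjTranspose_smul hc]
  have horth (x y : Fin n → ZMod d × ZMod d) (hxy : f x ≠ f y) : (V x)ᴴ * V y = 0 := by
    obtain ⟨z, hz, hsymp⟩ : ∃ z ∈ perp L, symp z (y - x) ≠ 0 := by
      by_contra! h
      exact hxy (LinearMap.sub_mem_ker_iff.1 (hker ▸ hperp _ h)).symm
    have hcomm : Commute (weylN ω z) (maxMixed C) :=
      (hC.commute_weylN_projMatrix hω.pow_eq_one hz).smul_right _
    rw [conjTranspose_replicateCol_vec_mul_replicateCol_vec, hA,
      conjTranspose_weylN_mul_weylN hω.pow_eq_one, Matrix.smul_mul, Matrix.trace_smul,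
      trace_weylN_mul_eq_zero hω hcomm hsymp, smul_zero]
    rfl
  have hentropy := vonNeumannEntropy_sum_isometry_of_fibers d hf hisometry hsame horth hp.2
  have hchannel : idTensor R (weylChannel ω p) (ketBra Ψ) = (Fintype.card Unit : ℂ)⁻¹ •
      ∑ x, (p x : ℂ) • (V x * (V x)ᴴ) := by
    simp only [weylChannel, idTensor_krausMap_sqrt_smul_ketBra hp.1, Fintype.card_unit,
      Nat.cast_one, inv_one, one_smul, V, ← ketBra_eq_replicateCol_mul_conjTranspose, A]
  rw [hchannel, hentropy, Fintype.card_unit, Nat.cast_one, Real.logb_one, add_zero]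

end Entropy

section PauliChannel

variable {d n k : ℕ} [NeZero d] {ω : ℂ} {P : ZMod d × ZMod d → ℝ}
  {g h : Fin n → (Fin n → ZMod d × ZMod d)} {C : Submodule ℂ (EuclideanSpace ℂ (Fin n → ZMod d))}

theorem IsSymplecticCode.vonNeumannEntropy_tensorPower_pauliChannel (hd : 1 < d)
    (hω : IsPrimitiveRoot ω d) (hP : IsProbDist P) (hk : k ≤ n) (hgh : IsHyperbolic g h)
    (hC : IsSymplecticCode ω k (lowSpan k g) C) :
    vonNeumannEntropy d (tensorPower n (pauliChannel ω P) (maxMixed C))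
      = shannonEntropy d (marginal (cosetDist hk g h P)) + k := by
  have hsurj : Function.Surjective (syndrome k g) :=
    Prod.fst_surjective.comp (hgh.cosetIndex_surjective hk)
  rw [tensorPower_pauliChannel ω hP.1, hgh.marginal_cosetDist]
  exact hC.vonNeumannEntropy_weylChannel_maxMixed hd hω (hP.prodDist n) hsurj
    fun _ => mem_ker_syndrome

theorem IsSymplecticCode.vonNeumannEntropy_idTensor_tensorPower_pauliChannel
    (hω : IsPrimitiveRoot ω d) (hP : IsProbDist P) (hk : k ≤ n) (hgh : IsHyperbolic g h)
    (hC : IsSymplecticCode ω k (lowSpan k g) C) {R : Type*} [Fintype R]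
    {Ψ : R × (Fin n → ZMod d) → ℂ} (hΨ : IsPurification Ψ (maxMixed C)) :
    vonNeumannEntropy d (idTensor R (tensorPower n (pauliChannel ω P)) (ketBra Ψ))
      = shannonEntropy d (marginal (cosetDist hk g h P))
        + condEntropy d (conditional (cosetDist hk g h P))
            (marginal (cosetDist hk g h P)) := by
  have hnonneg (su) : 0 ≤ cosetDist hk g h P su := by
    rw [hgh.cosetDist_eq_pushforward]
    exact pushforward_nonneg (hP.prodDist n).1 _ su
  rw [tensorPower_pauliChannel ω hP.1, ← shannonEntropy_eq_marginal_add_condEntropy d hnonneg,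
    hgh.cosetDist_eq_pushforward]
  exact hC.vonNeumannEntropy_idTensor_weylChannel_ketBra hω (hP.prodDist n)
    (hgh.cosetIndex_surjective hk) (hgh.ker_cosetIndex hk)
    (fun _ => hgh.mem_lowSpan_of_perp_perp hk) hΨ

end PauliChannel

end SympCode

theorem mainTheorem4_general {d : ℕ} [NeZero d] (hd : 1 < d) (ω : ℂ) (hω : IsPrimitiveRoot ω d)
    (P : ZMod d × ZMod d → ℝ) (hP : IsProbDist P) {n k : ℕ} (hk : k ≤ n)
    (g h : Fin n → (Fin n → ZMod d × ZMod d)) (hgh : IsHyperbolic g h)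
    (C : Submodule ℂ (EuclideanSpace ℂ (Fin n → ZMod d)))
    (hC : IsSymplecticCode ω k (lowSpan k g) C) :
    (k : ℝ) - condEntropy d (conditional (cosetDist hk g h P)) (marginal (cosetDist hk g h P))
        = coherentInformation d (maxMixed C) (tensorPower n (pauliChannel ω P)) ∧
      vonNeumannEntropy d (tensorPower n (pauliChannel ω P) (maxMixed C))
        = shannonEntropy d (marginal (cosetDist hk g h P)) + k ∧
      ∀ (R : Type*) [Fintype R] (Ψ : R × (Fin n → ZMod d) → ℂ), IsPurification Ψ (maxMixed C) →
        vonNeumannEntropy d (idTensor R (tensorPower n (pauliChannel ω P)) (ketBra Ψ))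
          = shannonEntropy d (marginal (cosetDist hk g h P))
            + condEntropy d (conditional (cosetDist hk g h P))
                (marginal (cosetDist hk g h P)) := by
  have houtput := hC.vonNeumannEntropy_tensorPower_pauliChannel hd hω hP hk hgh
  refine ⟨?_, houtput, fun R _ Ψ hΨ =>
    hC.vonNeumannEntropy_idTensor_tensorPower_pauliChannel hω hP hk hgh hΨ⟩
  rw [coherentInformation, houtput, hC.vonNeumannEntropy_idTensor_tensorPower_pauliChannel hω hP hk
    hgh (isPurification_canonicalPurification (posSemidef_maxMixed C))]
  ring

theorem mainTheorem4 {d : ℕ} [Fact d.Prime] (ω : ℂ) (hω : IsPrimitiveRoot ω d)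
    (P : ZMod d × ZMod d → ℝ) (hP : IsProbDist P)
    {n k : ℕ} (hk : k ≤ n)
    (L : Submodule (ZMod d) (Fin n → ZMod d × ZMod d))
    (hL : IsSelfOrthogonal L) (hdim : Module.finrank (ZMod d) L = n - k)
    (g h : Fin n → (Fin n → ZMod d × ZMod d)) (hgh : IsHyperbolic g h)
    (hspan : L = Submodule.span (ZMod d) (Set.range fun i : Fin (n - k) => g (lowIdx k i)))
    (C : Submodule ℂ (EuclideanSpace ℂ (Fin n → ZMod d)))
    (hC : IsSymplecticCode ω k L C) :
    (k : ℝ) - condEntropy d (conditional (cosetDist hk g h P)) (marginal (cosetDist hk g h P))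
        = coherentInformation d (maxMixed C) (tensorPower n (pauliChannel ω P)) ∧
      vonNeumannEntropy d (tensorPower n (pauliChannel ω P) (maxMixed C))
        = shannonEntropy d (marginal (cosetDist hk g h P)) + k ∧
      ∀ (R : Type) [Fintype R] (Ψ : R × (Fin n → ZMod d) → ℂ), IsPurification Ψ (maxMixed C) →
        vonNeumannEntropy d (idTensor R (tensorPower n (pauliChannel ω P)) (ketBra Ψ))
          = shannonEntropy d (marginal (cosetDist hk g h P))
            + condEntropy d (conditional (cosetDist hk g h P))
                (marginal (cosetDist hk g h P)) := by
  subst hspan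
  exact mainTheorem4_general (Fact.out : d.Prime).one_lt ω hω P hP hk g h hgh C hC
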